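/- **Setting.** Let $\mathcal L$ be the square lattice $\mathbb Z^2$, with vertex set $V$, set of unoriented edges $E$ and set of faces $\tilde V$. For a finite $\Lambda\subset E$ put $\mathcal H_\Lambda=\bigotimes_{e\in\Lambda}\mathbb C^2$ and $\mathcal A_\Lambda=\mathbb B(\mathcal H_\Lambda)$, and identify $a\in\mathcal A_{\Lambda'}$ with $a\otimes \mathbf 1_{\Lambda\setminus\Lambda'}\in\mathcal A_\Lambda$ when $\Lambda'\subset\Lambda$. Let $\mathcal A_{\rm loc}=\bigcup_\Lambda\mathcal A_\Lambda$, with its $C^*$-norm. For $v\in V$ let $A_v=\prod_{e\ni v}\sigma^x_e$, for $\tilde v\in\tilde V$ let $B_{\tilde v}=\prod_{e\in\partial\tilde v}\sigma^z_e$, and let $W=V\sqcup\tilde V$, $S_w=A_w$ for $w\in V$ and $S_w=B_w$ for $w\in\tilde V$. For $f\in\Omega=\{-1,1\}^W$ and finite $\Lambda\subset E$ define $$Q_w(f)=\tfrac12\big(\mathbf 1+f(w)S_w\big),\qquad P_\Lambda(f)=\prod_{w\in W:\,Q_w(f)\in\mathcal A_\Lambda}Q_w(f),$$ and, for $X\in\mathcal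 A_\Lambda$, $$\omega_\Lambda^f(X)=\frac{\mathrm{Tr}\big(P_\Lambda(f)XP_\Lambda(f)\big)}{\mathrm{Tr}\big(P_\Lambda(f)\big)},$$ where $\mathrm{Tr}$ is the trace over $\mathcal H_\Lambda$. **Theorem 3.6 (LTQO for all $f$).** For every $f\in\Omega$: 1. $\{P_\Lambda(f)\}_\Lambda$ is a frustration-free net of proper projections: each $P_\Lambda(f)$ is a non-zero orthogonal projection in $\mathcal A_\Lambda$, and $P_\Lambda(f)\le P_{\Lambda'}(f)$ whenever $\Lambda'\subset\Lambda$. 2. The net satisfies local topological quantum order: for every $X\in\mathcal A_{\rm loc}$, $$\lim_{\Lambda}\big\|P_\Lambda(f)XP_\Lambda(f)-\omega^f_\Lambda(X)P_\Lambda(f)\big\|=0,$$ the limit being along the finite subsets of $E$ directed by inclusion. 3. More precisely, for every finite $\Lambda\subset E$ there is a finite $\Delta\supset\Lambda$ such that $P_\Delta(f)XP_\Delta(f)=\omega^f_\Delta(X)P_\Delta(f)$ for all $X\in\mathcal A_\Lambda$. -/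

import Mathlib

open Filter Topology

namespace ToricCode

/-! ### The square lattice -/

/-- Vertices of the square lattice `ℤ²`. -/
abbrev Vertex : Type := ℤ × ℤ

/-- Faces of the square lattice, i.e. vertices of the dual lattice; the face `(x, y)` is the unit
square whose lower left corner is the vertex `(x, y)`. -/
abbrev Face : Type := ℤ × ℤ

/-- Unoriented edges of the square lattice: `(x, y, false)` is the horizontal edge joining `(x, y)`
to `(x + 1, y)`, and `(x, y, true)` is the vertical edge joining `(x, y)` to `(x, y + 1)`. -/
abbrev Edge : Type := ℤ × ℤ × Bool

/-- The two end points of an edge. -/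
def endpoints : Edge → Finset Vertex
  | (x, y, false) => {(x, y), (x + 1, y)}
  | (x, y, true) => {(x, y), (x, y + 1)}

/-- The star of a vertex: the four edges that end at it. -/
def vertexStar : Vertex → Finset Edge
  | (x, y) => {(x, y, false), (x - 1, y, false), (x, y, true), (x, y - 1, true)}

/-- The boundary of a face: its lower, upper, left and right edge. -/
def faceBoundary : Face → Finset Edge
  | (x, y) => {(x, y, false), (x, y + 1, false), (x, y, true), (x + 1, y, true)}

theorem mem_vertexStar_iff (e : Edge) (v : Vertex) : e ∈ vertexStar v ↔ v ∈ endpoints e := by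
  obtain ⟨x, y, b⟩ := e
  obtain ⟨x', y'⟩ := v
  cases b <;> simp [vertexStar, endpoints] <;> omega

/-! ### Local observables

The spin configurations with finitely many edges in the state `|1⟩` (and all others in `|0⟩`) are
encoded by the finite set of edges in the state `|1⟩`.  They label an orthonormal basis of
`⨂_{e ∈ E} (ℂ², |0⟩)`.  Likewise the subsets of a finite set `Λ` of edges label the product basis
of `H_Λ = ⨂_{e ∈ Λ} ℂ²`, so that `𝔹(H_Λ)` is the algebra of matrices indexed by `Λ.powerset`. -/

/-- The Hilbert space `⨂_{e ∈ E} (ℂ², |0⟩)` on which all observables act. -/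
abbrev Hilb : Type := lp (fun _ : Finset Edge => ℂ) 2

/-- Bounded operators on `Hilb`. -/
abbrev Op : Type := Hilb →L[ℂ] Hilb

/-- `𝔹(H_Λ)`, as matrices in the product basis of `H_Λ = ⨂_{e ∈ Λ} ℂ²`. -/
abbrev LocalMatrix (Λ : Finset Edge) : Type := Matrix Λ.powerset Λ.powerset ℂ

/-- The part of a configuration inside `Λ`. -/
def inside (Λ : Finset Edge) (c : Finset Edge) : Λ.powerset :=
  ⟨c ∩ Λ, by simp⟩

/-- The configuration that agrees with `s` inside `Λ` and with `c` outside `Λ`. -/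
def glue (Λ : Finset Edge) (c : Finset Edge) (s : Λ.powerset) : Finset Edge :=
  (c \ Λ) ∪ s

theorem inside_glue (Λ c : Finset Edge) (s : Λ.powerset) : inside Λ (glue Λ c s) = s := by
  obtain ⟨s, hs⟩ := s
  rw [Finset.mem_powerset] at hs
  apply Subtype.ext
  ext e
  have := @hs e
  simp only [inside, glue, Finset.mem_inter, Finset.mem_union, Finset.mem_sdiff]
  tauto

theorem glue_glue (Λ c : Finset Edge) (s t : Λ.powerset) :
    glue Λ (glue Λ c s) t = glue Λ c t := by
  obtain ⟨s, hs⟩ := s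
  obtain ⟨t, ht⟩ := t
  rw [Finset.mem_powerset] at hs ht
  ext e
  have := @hs e
  simp only [glue, Finset.mem_union, Finset.mem_sdiff]
  tauto

theorem glue_inside (Λ c : Finset Edge) : glue Λ c (inside Λ c) = c := by
  ext e
  simp only [glue, inside, Finset.mem_union, Finset.mem_sdiff, Finset.mem_inter]
  tauto

theorem summable_glue (Λ : Finset Edge) (s : Λ.powerset) (g : Finset Edge → ℝ)
    (hg : ∀ c, 0 ≤ g c) (hs : Summable g) :
    Summable (fun c => g (glue Λ c s)) ∧
      ∑' c, g (glue Λ c s) ≤ (Λ.powerset.card : ℝ) * ∑' c, g c := by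
  have hH : HasSum (fun p : Λ.powerset × Finset Edge => g p.2)
      ((Λ.powerset.card : ℝ) * ∑' c, g c) := by
    have hs' : Summable (fun p : Λ.powerset × Finset Edge => g p.2) := by
      rw [summable_prod_of_nonneg (fun p => hg p.2)]
      exact ⟨fun _ => hs, Summable.of_finite⟩
    have h := hs'.hasSum
    rw [hs'.tsum_prod' (fun _ => hs), tsum_fintype] at h
    simp only at h
    rw [Finset.sum_const, nsmul_eq_mul, Finset.card_univ, Fintype.card_coe] at h
    exact h
  have hinj : Function.Injective (fun c => (inside Λ c, glue Λ c s)) := by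
    intro c d h
    simp only [Prod.mk.injEq] at h
    rw [← glue_inside Λ c, ← glue_inside Λ d, ← glue_glue Λ c s, h.1, h.2, glue_glue]
  refine ⟨hH.summable.comp_injective hinj, ?_⟩
  rw [← hH.tsum_eq]
  exact tsum_comp_le_tsum_of_inj hH.summable (fun p => hg p.2) hinj

theorem hilb_summable (ψ : Hilb) : Summable (fun c => ‖ψ c‖ ^ 2) := by
  simpa using (lp.memℓp ψ).summable (by norm_num : 0 < (2 : ENNReal).toReal)

theorem hilb_norm_sq (ψ : Hilb) : ‖ψ‖ ^ 2 = ∑' c, ‖ψ c‖ ^ 2 := by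
  simpa using lp.norm_rpow_eq_tsum (by norm_num : 0 < (2 : ENNReal).toReal) ψ

/-- For a matrix `a` on `H_Λ` and `s ⊆ Λ`, the operator
`ψ ↦ (c ↦ a (c ∩ Λ) s * ψ (s inside Λ, c outside Λ))`. -/
noncomputable def column (Λ : Finset Edge) (a : LocalMatrix Λ) (s : Λ.powerset) : Op :=
  have key : ∀ ψ : Hilb, Summable (fun c => ‖a (inside Λ c) s * ψ (glue Λ c s)‖ ^ 2) ∧
      ∑' c, ‖a (inside Λ c) s * ψ (glue Λ c s)‖ ^ 2 ≤
        (∑ r, ‖a r s‖) ^ 2 * ((Λ.powerset.card : ℝ) * ‖ψ‖ ^ 2) := by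
    intro ψ
    obtain ⟨h1, h3⟩ := summable_glue Λ s (fun c => ‖ψ c‖ ^ 2) (fun _ => by positivity)
      (hilb_summable ψ)
    rw [← hilb_norm_sq] at h3
    have hle : ∀ c, ‖a (inside Λ c) s * ψ (glue Λ c s)‖ ^ 2 ≤
        (∑ r, ‖a r s‖) ^ 2 * ‖ψ (glue Λ c s)‖ ^ 2 := by
      intro c
      rw [norm_mul, mul_pow]
      gcongr
      exact Finset.single_le_sum (f := fun r => ‖a r s‖) (fun _ _ => norm_nonneg _)
        (Finset.mem_univ _)
    have hs := Summable.of_nonneg_of_le (fun _ => by positivity) hle (h1.mul_left _)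
    refine ⟨hs, (hs.tsum_le_tsum hle (h1.mul_left _)).trans ?_⟩
    rw [tsum_mul_left]
    gcongr
  LinearMap.mkContinuous
    { toFun := fun ψ => ⟨fun c => a (inside Λ c) s * ψ (glue Λ c s),
        memℓp_gen (by simpa using (key ψ).1)⟩
      map_add' := by
        intro ψ φ
        ext c
        exact mul_add _ _ _
      map_smul' := by
        intro z ψ
        ext c
        exact mul_left_comm _ _ _ }
    ((∑ r, ‖a r s‖) * Real.sqrt (Λ.powerset.card : ℝ))
    (by
      intro ψ
      refine (sq_le_sq₀ (norm_nonneg _) (by positivity)).1 ?_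
      have h := hilb_norm_sq ⟨fun c => a (inside Λ c) s * ψ (glue Λ c s),
        memℓp_gen (by simpa using (key ψ).1)⟩
      have h' := (key ψ).2
      rw [mul_pow, mul_pow, Real.sq_sqrt (by positivity), mul_assoc]
      refine le_trans (le_of_eq ?_) h'
      exact h)

/-- The operator `a ⊗ 1` on `Hilb`, for a matrix `a` on `H_Λ`. -/
noncomputable def amplifyOp (Λ : Finset Edge) (a : LocalMatrix Λ) : Op :=
  ∑ s, column Λ a s

theorem amplifyOp_apply (Λ : Finset Edge) (a : LocalMatrix Λ) (ψ : Hilb) (c : Finset Edge) :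
    amplifyOp Λ a ψ c = ∑ s, a (inside Λ c) s * ψ (glue Λ c s) := by
  simp only [amplifyOp, sum_apply]
  rw [lp.coeFn_sum, Finset.sum_apply]
  rfl

theorem op_ext {S T : Op} (h : ∀ ψ c, S ψ c = T ψ c) : S = T := by
  apply ContinuousLinearMap.ext
  intro ψ
  apply lp.ext
  funext c
  exact h ψ c

/-- The basis vector of `Hilb` labelled by the configuration `c`. -/
noncomputable def basisVec (c : Finset Edge) : Hilb := lp.single 2 c 1

theorem basisVec_apply (c d : Finset Edge) : basisVec c d = if d = c then 1 else 0 := by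
  by_cases h : d = c
  · subst h; simp [basisVec]
  · simp [basisVec, h]

theorem inner_basisVec (c : Finset Edge) (ψ : Hilb) : inner ℂ (basisVec c) ψ = ψ c := by
  simp [basisVec, lp.inner_single_left]

theorem glue_eq_iff (Λ c d : Finset Edge) (s : Λ.powerset) :
    glue Λ d s = c ↔ s = inside Λ c ∧ d = glue Λ c (inside Λ d) := by
  constructor
  · rintro rfl
    rw [inside_glue, glue_glue, glue_inside]
    exact ⟨rfl, rfl⟩
  · rintro ⟨rfl, h⟩
    rw [h, glue_glue, glue_inside]

theorem amplifyOp_conjTranspose (Λ : Finset Edge) (a : LocalMatrix Λ) :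
    amplifyOp Λ a.conjTranspose = ContinuousLinearMap.adjoint (amplifyOp Λ a) := by
  apply op_ext
  intro ψ c
  rw [← inner_basisVec c (ContinuousLinearMap.adjoint _ ψ),
    ContinuousLinearMap.adjoint_inner_right, amplifyOp_apply]
  have h : amplifyOp Λ a (basisVec c) = ∑ s, a s (inside Λ c) • basisVec (glue Λ c s) := by
    apply lp.ext
    funext d
    rw [amplifyOp_apply, lp.coeFn_sum, Finset.sum_apply]
    simp only [lp.coeFn_smul, Pi.smul_apply, smul_eq_mul, basisVec_apply]
    rw [Finset.sum_eq_single (inside Λ c), Finset.sum_eq_single (inside Λ d)]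
    · have : glue Λ d (inside Λ c) = c ↔ d = glue Λ c (inside Λ d) := by
        rw [glue_eq_iff]; simp
      simp only [this]
    · intro s _ hs
      rw [if_neg, mul_zero]
      intro h
      exact hs ((glue_eq_iff _ _ _ _).1 h.symm).1
    · simp
    · intro s _ hs
      rw [if_neg, mul_zero]
      intro h
      exact hs ((glue_eq_iff _ _ _ _).1 h).1
    · simp
  rw [h, sum_inner]
  apply Finset.sum_congr rfl
  intro s _
  rw [inner_smul_left, inner_basisVec]
  rfl

/-- The inclusion `𝔹(H_Λ) → 𝔹(Hilb)`, `a ↦ a ⊗ 1`, as a homomorphism of star algebras. -/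
noncomputable def amplify (Λ : Finset Edge) : LocalMatrix Λ →⋆ₐ[ℂ] Op where
  toFun := amplifyOp Λ
  map_one' := by
    apply op_ext
    intro ψ c
    rw [amplifyOp_apply, Finset.sum_eq_single (inside Λ c)]
    · rw [Matrix.one_apply_eq, one_mul, glue_inside]; rfl
    · intro s _ hs
      rw [Matrix.one_apply_ne (Ne.symm hs), zero_mul]
    · simp
  map_mul' a b := by
    apply op_ext
    intro ψ c
    change _ = amplifyOp Λ a (amplifyOp Λ b ψ) c
    simp only [amplifyOp_apply, inside_glue, glue_glue, Matrix.mul_apply, Finset.mul_sum,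
      Finset.sum_mul, mul_assoc]
    exact Finset.sum_comm
  map_zero' := by
    apply op_ext
    intro ψ c
    rw [amplifyOp_apply]
    simp
  map_add' a b := by
    apply op_ext
    intro ψ c
    change _ = amplifyOp Λ a ψ c + amplifyOp Λ b ψ c
    simp only [amplifyOp_apply, Matrix.add_apply, add_mul, Finset.sum_add_distrib]
  commutes' z := by
    apply op_ext
    intro ψ c
    rw [amplifyOp_apply, Finset.sum_eq_single (inside Λ c)]
    · rw [Matrix.algebraMap_matrix_apply, if_pos rfl, glue_inside]
      rfl
    · intro s _ hs
      rw [Matrix.algebraMap_matrix_apply, if_neg (Ne.symm hs), zero_mul]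
    · simp
  map_star' a := amplifyOp_conjTranspose Λ a

theorem amplify_apply (Λ : Finset Edge) (a : LocalMatrix Λ) (ψ : Hilb) (c : Finset Edge) :
    amplify Λ a ψ c = ∑ s, a (inside Λ c) s * ψ (glue Λ c s) :=
  amplifyOp_apply Λ a ψ c

/-- The algebra `𝒜_Λ = 𝔹(H_Λ) ⊗ 1` of observables supported in `Λ`. -/
noncomputable def localAlg (Λ : Finset Edge) : StarSubalgebra ℂ Op := (amplify Λ).range

/-- The algebra of local observables `𝒜_loc`, the union of all the `𝒜_Λ`.  Its norm closure is
the quasi-local algebra, whose norm is the operator norm. -/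
def localObservables : Set Op := ⋃ Λ : Finset Edge, (localAlg Λ : Set Op)

/-- The trace over `H_Λ` of an element of `𝒜_Λ`: the sum of the diagonal matrix elements
`⟨s, T s⟩` over the product basis of `H_Λ`. -/
noncomputable def localTrace (Λ : Finset Edge) (T : Op) : ℂ :=
  ∑ s ∈ Λ.powerset, inner ℂ (basisVec s) (T (basisVec s))

theorem localTrace_amplify (Λ : Finset Edge) (a : LocalMatrix Λ) :
    localTrace Λ (amplify Λ a) = a.trace := by
  rw [localTrace, Matrix.trace, ← Finset.sum_coe_sort]
  apply Finset.sum_congr rfl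
  intro s _
  have hs : inside Λ s = s := by
    apply Subtype.ext
    exact Finset.inter_eq_left.2 (Finset.mem_powerset.1 s.2)
  rw [inner_basisVec, amplify_apply, Finset.sum_eq_single s]
  · have h : glue Λ (s : Finset Edge) s = s := by
      rw [glue_eq_iff, hs]
      exact ⟨rfl, by conv_lhs => rw [← glue_inside Λ s, hs]⟩
    rw [hs, basisVec_apply, if_pos h, mul_one, Matrix.diag_apply]
  · intro t _ ht
    rw [basisVec_apply, if_neg, mul_zero]
    intro h
    exact ht (((glue_eq_iff _ _ _ _).1 h).1.trans hs)
  · simp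

/-! ### Star and face operators -/

/-- The state, `0` or `1`, of the edge `e` in the configuration `s`. -/
def spin (e : Edge) (s : Finset Edge) : Fin 2 := if e ∈ s then 1 else 0

/-- The `2 × 2` matrix `M` acting on the edge `e`. -/
noncomputable def siteOp (e : Edge) (M : Matrix (Fin 2) (Fin 2) ℂ) : Op :=
  amplify {e} (Matrix.of fun s t => M (spin e s) (spin e t))

/-- The Pauli matrix `σ^x` on the edge `e`. -/
noncomputable def sigmaX (e : Edge) : Op := siteOp e !![0, 1; 1, 0]

/-- The Pauli matrix `σ^z` on the edge `e`. -/
noncomputable def sigmaZ (e : Edge) : Op := siteOp e !![1, 0; 0, -1]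

theorem siteOp_apply (e : Edge) (M : Matrix (Fin 2) (Fin 2) ℂ) (ψ : Hilb) (c : Finset Edge) :
    siteOp e M ψ c = M (spin e c) 0 * ψ (c \ {e}) + M (spin e c) 1 * ψ (c \ {e} ∪ {e}) := by
  rw [siteOp, amplify_apply]
  have h := Finset.sum_coe_sort ({e} : Finset Edge).powerset
    (fun s => M (spin e (c ∩ {e})) (spin e s) * ψ (c \ {e} ∪ s))
  refine Eq.trans h ?_
  have h' : ({e} : Finset Edge).powerset = {∅, {e}} := by
    ext x
    simp [Finset.subset_singleton_iff]
  rw [h', Finset.sum_pair (by simp)]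
  simp [spin]

theorem sigmaX_apply (e : Edge) (ψ : Hilb) (c : Finset Edge) :
    sigmaX e ψ c = ψ (symmDiff c {e}) := by
  rw [sigmaX, siteOp_apply]
  by_cases h : e ∈ c
  · have : symmDiff c {e} = c \ {e} := by
      ext x; simp only [Finset.mem_symmDiff, Finset.mem_sdiff, Finset.mem_singleton]; grind
    simp [spin, h, this]
  · have : symmDiff c {e} = c \ {e} ∪ {e} := by
      ext x
      simp only [Finset.mem_symmDiff, Finset.mem_sdiff, Finset.mem_singleton, Finset.mem_union]
      grind
    rw [this]
    simp [spin, h]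

theorem sigmaZ_apply (e : Edge) (ψ : Hilb) (c : Finset Edge) :
    sigmaZ e ψ c = (if e ∈ c then -1 else 1) * ψ c := by
  rw [sigmaZ, siteOp_apply]
  by_cases h : e ∈ c
  · have : c \ {e} ∪ {e} = c := by
      ext x; simp only [Finset.mem_sdiff, Finset.mem_singleton, Finset.mem_union]; grind
    rw [this]
    simp [spin, h]
  · have : c \ {e} = c := by
      ext x; simp only [Finset.mem_sdiff, Finset.mem_singleton]; grind
    rw [this]
    simp [spin, h]

theorem sigmaX_comm (e e' : Edge) : Commute (sigmaX e) (sigmaX e') := by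
  apply op_ext
  intro ψ c
  change sigmaX e (sigmaX e' ψ) c = sigmaX e' (sigmaX e ψ) c
  simp only [sigmaX_apply]
  rw [symmDiff_right_comm]

theorem sigmaZ_comm (e e' : Edge) : Commute (sigmaZ e) (sigmaZ e') := by
  apply op_ext
  intro ψ c
  change sigmaZ e (sigmaZ e' ψ) c = sigmaZ e' (sigmaZ e ψ) c
  simp only [sigmaZ_apply]
  ring

/-- The star operator `A_v = ∏_{e ∋ v} σ^x_e`. -/
noncomputable def starOp (v : Vertex) : Op :=
  (vertexStar v).noncommProd sigmaX (fun _ _ _ _ _ => sigmaX_comm _ _)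

/-- The face operator `B_p = ∏_{e ∈ p} σ^z_e`. -/
noncomputable def faceOp (p : Face) : Op :=
  (faceBoundary p).noncommProd sigmaZ (fun _ _ _ _ _ => sigmaZ_comm _ _)

theorem prod_sigmaX_apply (a : Finset Edge) (ψ : Hilb) (c : Finset Edge) :
    a.noncommProd sigmaX (fun _ _ _ _ _ => sigmaX_comm _ _) ψ c = ψ (symmDiff c a) := by
  induction a using Finset.induction_on generalizing c with
  | empty =>
    refine (congrArg (fun T : Op => T ψ c) (Finset.noncommProd_empty sigmaX _)).trans ?_
    exact congrArg ψ (symmDiff_bot c).symm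
  | insert e a he ih =>
    refine (congrArg (fun T : Op => T ψ c)
      (Finset.noncommProd_insert_of_notMem a e sigmaX _ he)).trans ?_
    change sigmaX e (Finset.noncommProd a sigmaX _ ψ) c = _
    have h : symmDiff (symmDiff c {e}) a = symmDiff c (insert e a) := by
      ext x
      simp only [Finset.mem_symmDiff, Finset.mem_insert, Finset.mem_singleton]
      grind
    rw [sigmaX_apply, ih, h]

theorem prod_sigmaZ_apply (a : Finset Edge) (ψ : Hilb) (c : Finset Edge) :
    a.noncommProd sigmaZ (fun _ _ _ _ _ => sigmaZ_comm _ _) ψ c =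
      (∏ e ∈ a, if e ∈ c then -1 else 1) * ψ c := by
  induction a using Finset.induction_on with
  | empty =>
    refine (congrArg (fun T : Op => T ψ c) (Finset.noncommProd_empty sigmaZ _)).trans ?_
    rw [Finset.prod_empty, one_mul]
    rfl
  | insert e a he ih =>
    refine (congrArg (fun T : Op => T ψ c)
      (Finset.noncommProd_insert_of_notMem a e sigmaZ _ he)).trans ?_
    rw [Finset.prod_insert he]
    change sigmaZ e (Finset.noncommProd a sigmaZ _ ψ) c = _
    rw [sigmaZ_apply, ih, mul_assoc]

theorem starOp_apply (v : Vertex) (ψ : Hilb) (c : Finset Edge) :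
    starOp v ψ c = ψ (symmDiff c (vertexStar v)) := prod_sigmaX_apply _ ψ c

theorem faceOp_apply (p : Face) (ψ : Hilb) (c : Finset Edge) :
    faceOp p ψ c = (∏ e ∈ faceBoundary p, if e ∈ c then -1 else 1) * ψ c :=
  prod_sigmaZ_apply _ ψ c

theorem prod_overlap (v : Vertex) (p : Face) :
    (∏ e ∈ faceBoundary p, if e ∈ vertexStar v then (-1 : ℂ) else 1) = 1 := by
  obtain ⟨x, y⟩ := v
  obtain ⟨x', y'⟩ := p
  rw [faceBoundary, Finset.prod_insert (by simp), Finset.prod_insert (by simp),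
    Finset.prod_insert (by simp), Finset.prod_singleton]
  by_cases h1 : x = x' <;> by_cases h2 : x = x' + 1 <;> by_cases h3 : y = y' <;>
    by_cases h4 : y = y' + 1 <;> simp [vertexStar] <;> grind

theorem starOp_faceOp_comm (v : Vertex) (p : Face) : Commute (starOp v) (faceOp p) := by
  apply op_ext
  intro ψ c
  change starOp v (faceOp p ψ) c = faceOp p (starOp v ψ) c
  simp only [starOp_apply, faceOp_apply]
  congr 1
  have h := prod_overlap v p
  rw [← mul_one (∏ e ∈ faceBoundary p, if e ∈ c then (-1 : ℂ) else 1), ← h,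
    ← Finset.prod_mul_distrib]
  apply Finset.prod_congr rfl
  intro e _
  simp only [Finset.mem_symmDiff]
  by_cases h1 : e ∈ c <;> by_cases h2 : e ∈ vertexStar v <;> simp [h1, h2]

/-- The set `W = V ∪ Ṽ` of all vertices and faces (a disjoint union). -/
abbrev Site : Type := Vertex ⊕ Face

/-- The operator `S_w`: a star operator if `w` is a vertex, a face operator if `w` is a face. -/
noncomputable def stabilizer : Site → Op
  | Sum.inl v => starOp v
  | Sum.inr p => faceOp p

/-- Configurations `f ∈ Ω = {1, -1}^W`. -/
abbrev SignConfig : Type := Site → ℤˣ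

/-- `Q_w(f) = ½ (1 + f(w) S_w)`. -/
noncomputable def siteProj (f : SignConfig) (w : Site) : Op :=
  (1 / 2 : ℂ) • (1 + ((f w : ℤ) : ℂ) • stabilizer w)

theorem stabilizer_comm (w w' : Site) : Commute (stabilizer w) (stabilizer w') := by
  have hX : ∀ v v', Commute (starOp v) (starOp v') := by
    intro v v'
    apply op_ext
    intro ψ c
    change starOp v (starOp v' ψ) c = starOp v' (starOp v ψ) c
    simp only [starOp_apply]
    rw [symmDiff_right_comm]
  have hZ : ∀ p p', Commute (faceOp p) (faceOp p') := by
    intro p p'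
    apply op_ext
    intro ψ c
    change faceOp p (faceOp p' ψ) c = faceOp p' (faceOp p ψ) c
    simp only [faceOp_apply]
    ring
  cases w <;> cases w'
  · exact hX _ _
  · exact starOp_faceOp_comm _ _
  · exact (starOp_faceOp_comm _ _).symm
  · exact hZ _ _

theorem siteProj_comm (f : SignConfig) (w w' : Site) :
    Commute (siteProj f w) (siteProj f w') := by
  have h := stabilizer_comm w w'
  refine Commute.smul_left (Commute.smul_right ?_ _) _
  refine Commute.add_left (Commute.one_left _) (Commute.add_right (Commute.one_right _) ?_)
  exact Commute.smul_left (Commute.smul_right h _) _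

/-- The edges on which `S_w` acts. -/
def support : Site → Finset Edge
  | Sum.inl v => vertexStar v
  | Sum.inr p => faceBoundary p

theorem support_subset_of_mem (Λ : Finset Edge) (w : Site) (h : stabilizer w ∈ localAlg Λ) :
    support w ⊆ Λ := by
  obtain ⟨a, ha⟩ := h
  change amplify Λ a = _ at ha
  intro e he
  by_contra heΛ
  cases w with
  | inl v =>
    have h1 : starOp v (basisVec (vertexStar v)) ∅ = 1 := by
      rw [starOp_apply, basisVec_apply, if_pos]
      exact bot_symmDiff _
    change amplify Λ a = starOp v at ha
    rw [← ha, amplify_apply, Finset.sum_eq_zero] at h1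
    · exact zero_ne_one h1
    · intro s _
      rw [basisVec_apply, if_neg, mul_zero]
      intro h2
      change e ∈ vertexStar v at he
      rw [← h2, glue, Finset.mem_union] at he
      rcases he with he | he
      · simp at he
      · exact heΛ (Finset.mem_powerset.1 s.2 he)
  | inr p =>
    change amplify Λ a = faceOp p at ha
    have hin : inside Λ {e} = inside Λ ∅ := by
      apply Subtype.ext
      simp [inside, heΛ]
    have key : ∀ c, faceOp p (basisVec c) c = a (inside Λ c) (inside Λ c) := by
      intro c
      rw [← ha, amplify_apply, Finset.sum_eq_single (inside Λ c)]
      · rw [glue_inside, basisVec_apply, if_pos rfl, mul_one]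
      · intro s _ hs
        rw [basisVec_apply, if_neg, mul_zero]
        intro h
        exact hs ((glue_eq_iff _ _ _ _).1 h).1
      · simp
    have h0 := key ∅
    have h1 := key {e}
    rw [hin, ← h0] at h1
    change e ∈ faceBoundary p at he
    simp only [faceOp_apply, basisVec_apply, if_true, mul_one, Finset.notMem_empty, if_false,
      Finset.prod_const_one, Finset.mem_singleton, Finset.prod_ite_eq', he] at h1
    norm_num at h1

theorem siteProj_mem_iff (f : SignConfig) (Λ : Finset Edge) (w : Site) :
    siteProj f w ∈ localAlg Λ ↔ stabilizer w ∈ localAlg Λ := by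
  have hf : ((f w : ℤ) : ℂ) * ((f w : ℤ) : ℂ) = 1 := by
    rcases Int.units_eq_one_or (f w) with h | h <;> simp [h]
  constructor
  · intro h
    have h2 : stabilizer w = ((f w : ℤ) : ℂ) • ((2 : ℂ) • siteProj f w - 1) := by
      rw [siteProj, smul_smul, smul_sub, smul_smul, smul_add, smul_smul]
      norm_num
      simp [hf]
    rw [h2]
    exact (localAlg Λ).smul_mem (sub_mem ((localAlg Λ).smul_mem h _) (one_mem _)) _
  · intro h
    exact (localAlg Λ).smul_mem (add_mem (one_mem _) ((localAlg Λ).smul_mem h _)) _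

theorem finite_siteProj_mem (f : SignConfig) (Λ : Finset Edge) :
    {w : Site | siteProj f w ∈ localAlg Λ}.Finite := by
  have hfin : Set.Finite ((Sum.inl '' ((fun e : Edge => (e.1, e.2.1)) '' (Λ : Set Edge)) ∪
      Sum.inr '' ((fun e : Edge => (e.1, e.2.1)) '' (Λ : Set Edge)) : Set Site)) :=
    ((Λ.finite_toSet.image _).image _).union ((Λ.finite_toSet.image _).image _)
  refine hfin.subset ?_
  intro w hw
  have hs := support_subset_of_mem Λ w ((siteProj_mem_iff f Λ w).1 hw)
  cases w with
  | inl v =>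
    refine Or.inl ⟨v, ⟨(v.1, v.2, false), hs ?_, rfl⟩, rfl⟩
    simp [support, vertexStar]
  | inr p =>
    refine Or.inr ⟨p, ⟨(p.1, p.2, false), hs ?_, rfl⟩, rfl⟩
    simp [support, faceBoundary]

/-- `P_Λ(f)`, the product of all the `Q_w(f)` that belong to `𝒜_Λ`. -/
noncomputable def groundProj (f : SignConfig) (Λ : Finset Edge) : Op :=
  (finite_siteProj_mem f Λ).toFinset.noncommProd (siteProj f)
    (fun _ _ _ _ _ => siteProj_comm f _ _)

/-! ### Nets of projections and local topological quantum order -/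

/-- A frustration-free net of proper (that is, non-zero) local projections, indexed by the finite
sets of edges: it decreases as the region grows. -/
structure IsFrustrationFreeNet (Q : Finset Edge → Op) : Prop where
  mem_localAlg : ∀ Λ, Q Λ ∈ localAlg Λ
  isStarProjection : ∀ Λ, IsStarProjection (Q Λ)
  ne_zero : ∀ Λ, Q Λ ≠ 0
  le_of_subset : ∀ Λ' Λ, Λ' ⊆ Λ → Q Λ ≤ Q Λ'

/-- `ω_Λ(X) = Tr(Q_Λ X Q_Λ) / Tr(Q_Λ)` for `X ∈ 𝒜_Λ`, with the trace over `H_Λ`. -/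
noncomputable def localState (Q : Finset Edge → Op) (Λ : Finset Edge) (X : Op) : ℂ :=
  localTrace Λ (Q Λ * X * Q Λ) / localTrace Λ (Q Λ)

/-- Local topological quantum order: `‖Q_Λ X Q_Λ - ω_Λ(X) Q_Λ‖ → 0` for every local observable
`X`, along the finite sets `Λ` of edges ordered by inclusion. -/
def IsLTQO (Q : Finset Edge → Op) : Prop :=
  ∀ X ∈ localObservables,
    Tendsto (fun Λ => ‖Q Λ * X * Q Λ - localState Q Λ X • Q Λ‖) atTop (𝓝 0)

end ToricCode

/-!
The Pauli strings `σ^x(a) σ^z(b)`, `a, b ⊆ Λ`, span `𝒜_Λ`. If `b` is not a cycle, or `a` is not a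
cocycle, then the string anticommutes with some stabilizer `S_w`, so that
`Q_w σ^x(a) σ^z(b) Q_w = 0`, and its compression by `P_Δ` vanishes as soon as `Δ` contains the
support of `S_w`. A finite cycle of `ℤ²` is a sum modulo 2 of face boundaries, and dually a finite
cocycle is a sum of vertex stars; hence every remaining string is a product of stabilizers and acts
as a scalar on `P_Δ` once `Δ` is large. There are finitely many strings in `Λ`, so one `Δ` serves
all of `𝒜_Λ`.

The product `P_Λ` is not zero because among finitely many sites, the sign of a rightmost one can be
flipped by a single-edge Pauli matrix that commutes with all the other stabilizers.
-/

namespace ToricCode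

open scoped symmDiff Finset

/-! ### Sums of finite sets modulo 2 -/

section Parity

variable {α β : Type*} [DecidableEq α] [DecidableEq β] {𝒢 ℋ : Set (Finset α)} {a b : Finset α}

/-- The `𝔽₂`-linear span of a family of finite sets, where a finite set stands for its indicator
vector over `𝔽₂`, so that addition is the symmetric difference. -/
inductive SymmDiffClosure (𝒢 : Set (Finset α)) : Finset α → Prop
  | empty : SymmDiffClosure 𝒢 ∅
  | basic {a : Finset α} : a ∈ 𝒢 → SymmDiffClosure 𝒢 a
  | symmDiff {a b : Finset α} :
      SymmDiffClosure 𝒢 a → SymmDiffClosure 𝒢 b → SymmDiffClosure 𝒢 (a ∆ b)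

namespace SymmDiffClosure

theorem iff_of_symmDiff (h : SymmDiffClosure 𝒢 (a ∆ b)) :
    SymmDiffClosure 𝒢 a ↔ SymmDiffClosure 𝒢 b where
  mp ha := by simpa using ha.symmDiff h
  mpr hb := by simpa using h.symmDiff hb

theorem of_forall_singleton (h : ∀ i ∈ a, SymmDiffClosure 𝒢 {i}) : SymmDiffClosure 𝒢 a := by
  induction a using Finset.induction_on with
  | empty => exact empty
  | insert i a hi ih =>
    have hia : {i} ∆ a = insert i a := by
      rw [(Finset.disjoint_singleton_left.2 hi).symmDiff_eq_sup, Finset.sup_eq_union,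
        Finset.singleton_union]
    rw [← hia]
    exact (h i (Finset.mem_insert_self i a)).symmDiff
      (ih fun j hj => h j (Finset.mem_insert_of_mem hj))

theorem exists_symmDiff_eq_of_union (h : SymmDiffClosure (𝒢 ∪ ℋ) a) :
    ∃ b c, SymmDiffClosure 𝒢 b ∧ SymmDiffClosure ℋ c ∧ b ∆ c = a := by
  induction h with
  | empty => exact ⟨∅, ∅, empty, empty, symmDiff_self _⟩
  | @basic a ha =>
    rcases ha with ha | ha
    · exact ⟨a, ∅, basic ha, empty, symmDiff_bot a⟩
    · exact ⟨∅, a, empty, basic ha, bot_symmDiff a⟩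
  | symmDiff _ _ iha ihb =>
    obtain ⟨b, c, hb, hc, rfl⟩ := iha
    obtain ⟨b', c', hb', hc', rfl⟩ := ihb
    exact ⟨_, _, hb.symmDiff hb', hc.symmDiff hc', symmDiff_symmDiff_symmDiff_comm ..⟩

theorem coe_subset {S : Set α} (h𝒢 : ∀ b ∈ 𝒢, (b : Set α) ⊆ S) (h : SymmDiffClosure 𝒢 a) :
    (a : Set α) ⊆ S := by
  induction h with
  | empty => simp
  | basic ha => exact h𝒢 _ ha
  | symmDiff _ _ iha ihb =>
    rw [Finset.coe_symmDiff]
    exact Set.symmDiff_subset_union.trans (Set.union_subset iha ihb)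

theorem map {e : α ↪ β} {ℋ : Set (Finset β)}
    (h𝒢 : ∀ b ∈ 𝒢, SymmDiffClosure ℋ (b.map e)) (h : SymmDiffClosure 𝒢 a) :
    SymmDiffClosure ℋ (a.map e) := by
  induction h with
  | empty => exact empty
  | basic ha => exact h𝒢 _ ha
  | symmDiff _ _ iha ihb =>
    rw [Finset.map_eq_image, Finset.image_symmDiff _ _ e.injective, ← Finset.map_eq_image,
      ← Finset.map_eq_image]
    exact iha.symmDiff ihb

end SymmDiffClosure

/-- The sign `(-1)^|a ∩ b|`, that is, the mod 2 intersection pairing of `a` and `b` written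
multiplicatively. -/
def overlapSign (a b : Finset α) : ℂ := (-1) ^ #(a ∩ b)

theorem overlapSign_eq_prod (a b : Finset α) :
    overlapSign a b = ∏ i ∈ a, if i ∈ b then -1 else 1 := by
  rw [Finset.prod_ite_mem, Finset.prod_const, overlapSign]

theorem overlapSign_comm (a b : Finset α) : overlapSign a b = overlapSign b a := by
  rw [overlapSign, Finset.inter_comm, overlapSign]

@[simp]
theorem overlapSign_empty_right (a : Finset α) : overlapSign a ∅ = 1 := by simp [overlapSign]

theorem overlapSign_symmDiff_right (a b c : Finset α) :
    overlapSign a (b ∆ c) = overlapSign a b * overlapSign a c := by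
  simp only [overlapSign_eq_prod, ← Finset.prod_mul_distrib]
  refine Finset.prod_congr rfl fun i _ => ?_
  by_cases hb : i ∈ b <;> by_cases hc : i ∈ c <;> simp [Finset.mem_symmDiff, hb, hc]

theorem overlapSign_eq_one_or (a b : Finset α) : overlapSign a b = 1 ∨ overlapSign a b = -1 :=
  neg_one_pow_eq_or ℂ _

theorem overlapSign_mul_self (a b : Finset α) : overlapSign a b * overlapSign a b = 1 := by
  rw [← overlapSign_symmDiff_right, symmDiff_self]
  exact overlapSign_empty_right a

theorem overlapSign_singleton_right (a : Finset α) (i : α) :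
    overlapSign a {i} = if i ∈ a then -1 else 1 := by
  rw [overlapSign_comm, overlapSign_eq_prod, Finset.prod_singleton]

theorem overlapSign_map (e : α ↪ β) (a b : Finset α) :
    overlapSign (a.map e) (b.map e) = overlapSign a b := by
  rw [overlapSign, ← Finset.map_inter, Finset.card_map, overlapSign]

theorem SymmDiffClosure.overlapSign_eq_one (h : SymmDiffClosure 𝒢 b)
    (h𝒢 : ∀ c ∈ 𝒢, overlapSign a c = 1) : overlapSign a b = 1 := by
  induction h with
  | empty => exact overlapSign_empty_right a
  | basic hb => exact h𝒢 _ hb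
  | symmDiff _ _ ihb ihc => rw [overlapSign_symmDiff_right, ihb, ihc, one_mul]

theorem sum_powerset_overlapSign (a b : Finset α) :
    ∑ c ∈ a.powerset, overlapSign c b = if Disjoint a b then (2 : ℂ) ^ #a else 0 := by
  simp only [overlapSign_eq_prod, ← Finset.prod_one_add]
  split_ifs with h
  · rw [← Finset.prod_const]
    refine Finset.prod_congr rfl fun i hi => ?_
    rw [if_neg (Finset.disjoint_left.1 h hi), one_add_one_eq_two]
  · obtain ⟨i, hia, hib⟩ := Finset.not_disjoint_iff.1 h
    exact Finset.prod_eq_zero hia (by simp [hib])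

end Parity

/-! ### Finite cycles and cocycles of the square lattice -/

/-- A finite set of edges is a cycle (with `𝔽₂` coefficients) if it contains an even number of
edges at every vertex. -/
def IsCycle (b : Finset Edge) : Prop := ∀ v, overlapSign (vertexStar v) b = 1

/-- A finite set of edges is a cocycle (with `𝔽₂` coefficients) if it contains an even number of
edges of every face; equivalently, it is a cycle of the dual lattice. -/
def IsCocycle (a : Finset Edge) : Prop := ∀ p, overlapSign (faceBoundary p) a = 1

theorem isCycle_faceBoundary (p : Face) : IsCycle (faceBoundary p) := fun v => by
  rw [overlapSign_comm, overlapSign_eq_prod, prod_overlap]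

/-- A spanning tree of the lattice: the axis `x = 0` together with all the horizontal edges. -/
def comb : Set Edge := {e | e.2.2 = true → e.1 = 0}

theorem faceBoundary_symmDiff_horizontal (x y : ℤ) :
    faceBoundary (x, y) ∆ ({(x, y, false)} ∆ {(x, y + 1, false)}) =
      {(x + 1, y, true)} ∆ {(x, y, true)} := by
  ext ⟨x', y', d⟩
  cases d <;> simp [faceBoundary, Finset.mem_symmDiff] <;> grind

/-- Subtracting face boundaries moves a vertical edge to the axis. -/
theorem symmDiffClosure_faceBoundary_union_comb (a : Finset Edge) :
    SymmDiffClosure (Set.range faceBoundary ∪ singleton '' comb) a := by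
  have of_mem_comb : ∀ e ∈ comb, SymmDiffClosure (Set.range faceBoundary ∪ singleton '' comb) {e} :=
    fun e he => .basic (.inr ⟨e, he, rfl⟩)
  have vertical_succ_iff (x y : ℤ) :
      SymmDiffClosure (Set.range faceBoundary ∪ singleton '' comb) {(x + 1, y, true)} ↔
        SymmDiffClosure (Set.range faceBoundary ∪ singleton '' comb) {(x, y, true)} := by
    refine SymmDiffClosure.iff_of_symmDiff ?_
    rw [← faceBoundary_symmDiff_horizontal]
    exact (SymmDiffClosure.basic (.inl ⟨_, rfl⟩)).symmDiff
      ((of_mem_comb _ (by simp [comb])).symmDiff (of_mem_comb _ (by simp [comb])))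
  refine SymmDiffClosure.of_forall_singleton ?_
  rintro ⟨x, y, _ | _⟩ -
  · exact of_mem_comb _ (by simp [comb])
  · induction x using Int.induction_on with
    | zero => exact of_mem_comb _ (by simp [comb])
    | succ n ih => exact (vertical_succ_iff n y).2 ih
    | pred n ih => exact (vertical_succ_iff (-n - 1) y).1 (by rwa [sub_add_cancel])

theorem IsCycle.even_at_vertex {b : Finset Edge} (hb : IsCycle b) (x y : ℤ) :
    ((x, y, false) ∈ b ↔ (x - 1, y, false) ∈ b) ↔ ((x, y, true) ∈ b ↔ (x, y - 1, true) ∈ b) := by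
  have h := hb (x, y)
  rw [overlapSign_eq_prod, vertexStar, Finset.prod_insert (by simp; omega),
    Finset.prod_insert (by simp), Finset.prod_insert (by simp; omega), Finset.prod_singleton] at h
  by_cases h1 : (x, y, false) ∈ b <;> by_cases h2 : (x - 1, y, false) ∈ b <;>
    by_cases h3 : (x, y, true) ∈ b <;> by_cases h4 : (x, y - 1, true) ∈ b <;>
    simp [h1, h2, h3, h4] at h ⊢ <;> norm_num at h

theorem notMem_of_forall_succ {α : Type*} {s : Finset α} {u : ℕ → α} (hu : Function.Injective u)
    (h : ∀ n, u n ∈ s → u (n + 1) ∈ s) : u 0 ∉ s := fun h0 =>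
  Set.infinite_range_of_injective hu
    (s.finite_toSet.subset (Set.range_subset_iff.2 fun n => Nat.rec h0 h n))

theorem IsCycle.horizontal_notMem {b : Finset Edge} (hb : IsCycle b) (hcomb : (b : Set Edge) ⊆ comb)
    (x y : ℤ) : (x, y, false) ∉ b := by
  have off_axis : ∀ x, x ≠ 0 → ((x, y, false) ∈ b ↔ (x - 1, y, false) ∈ b) := fun x hx => by
    have no_vertical : ∀ y', (x, y', true) ∉ b := fun y' h => hx (hcomb h rfl)
    simp [hb.even_at_vertex x y, no_vertical]
  rcases le_or_gt 0 x with hx | hx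
  · have ray := notMem_of_forall_succ (s := b) (u := fun n : ℕ => (x + n, y, false))
      (fun m n hmn => by simpa using hmn) fun n hn => by
        rwa [off_axis _ (by omega), Nat.cast_succ, ← add_assoc, add_sub_cancel_right]
    simpa using ray
  · have ray := notMem_of_forall_succ (s := b) (u := fun n : ℕ => (x - n, y, false))
      (fun m n hmn => by simpa using hmn) fun n hn => by
        rwa [Nat.cast_succ, ← sub_sub, ← off_axis _ (by omega)]
    simpa using ray

theorem IsCycle.axis_notMem {b : Finset Edge} (hb : IsCycle b) (hcomb : (b : Set Edge) ⊆ comb)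
    (y : ℤ) : (0, y, true) ∉ b := by
  have ray := notMem_of_forall_succ (s := b) (u := fun n : ℕ => (0, y + n, true))
    (fun m n hmn => by simpa using hmn) fun n hn => by
      have h := hb.even_at_vertex 0 (y + (n + 1 : ℕ))
      simp only [hb.horizontal_notMem hcomb, true_iff] at h
      rwa [h, Nat.cast_succ, ← add_assoc, add_sub_cancel_right]
  simpa using ray

theorem IsCycle.eq_empty_of_subset_comb {b : Finset Edge} (hb : IsCycle b)
    (hcomb : (b : Set Edge) ⊆ comb) : b = ∅ := by
  refine Finset.eq_empty_of_forall_notMem ?_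
  rintro ⟨x, y, _ | _⟩ he
  · exact hb.horizontal_notMem hcomb x y he
  · obtain rfl : x = 0 := hcomb he rfl
    exact hb.axis_notMem hcomb y he

theorem IsCycle.symmDiffClosure {b : Finset Edge} (hb : IsCycle b) :
    SymmDiffClosure (Set.range faceBoundary) b := by
  obtain ⟨c, d, hc, hd, rfl⟩ :=
    (symmDiffClosure_faceBoundary_union_comb b).exists_symmDiff_eq_of_union
  have cycle_d : IsCycle d := fun v => by
    have sign_c : overlapSign (vertexStar v) c = 1 :=
      hc.overlapSign_eq_one (by rintro _ ⟨p, rfl⟩; exact isCycle_faceBoundary p v)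
    simpa [overlapSign_symmDiff_right, sign_c] using hb v
  have d_subset : (d : Set Edge) ⊆ comb :=
    hd.coe_subset (by rintro _ ⟨e, he, rfl⟩; simpa using he)
  rw [cycle_d.eq_empty_of_subset_comb d_subset]
  exact (symmDiff_bot c).symm ▸ hc

/-- The identification of each edge with the edge of the dual lattice that crosses it. The dual
lattice is labelled so that the face `(x, y)` becomes the vertex `(x, y)`. -/
def dualEdge : Edge ≃ Edge where
  toFun | (x, y, false) => (x, y - 1, true) | (x, y, true) => (x - 1, y, false)
  invFun | (x, y, true) => (x, y + 1, false) | (x, y, false) => (x + 1, y, true)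
  left_inv := by rintro ⟨x, y, _ | _⟩ <;> simp
  right_inv := by rintro ⟨x, y, _ | _⟩ <;> simp

theorem map_dualEdge_faceBoundary (p : Face) :
    (faceBoundary p).map dualEdge.toEmbedding = vertexStar p := by
  ext ⟨x, y, d⟩
  cases d <;> simp [dualEdge, faceBoundary, vertexStar] <;> grind

theorem map_dualEdge_symm_faceBoundary (p : Face) :
    (faceBoundary p).map dualEdge.symm.toEmbedding = vertexStar (p + 1) := by
  ext ⟨x, y, d⟩
  cases d <;> simp [dualEdge, faceBoundary, vertexStar] <;> grind

theorem IsCocycle.isCycle_map_dualEdge {a : Finset Edge} (ha : IsCocycle a) :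
    IsCycle (a.map dualEdge.toEmbedding) := fun v => by
  rw [← map_dualEdge_faceBoundary, overlapSign_map, ha v]

theorem IsCocycle.symmDiffClosure {a : Finset Edge} (ha : IsCocycle a) :
    SymmDiffClosure (Set.range vertexStar) a := by
  have h : SymmDiffClosure (Set.range vertexStar)
      ((a.map dualEdge.toEmbedding).map dualEdge.symm.toEmbedding) :=
    ha.isCycle_map_dualEdge.symmDiffClosure.map (by
      rintro _ ⟨p, rfl⟩
      exact .basic ⟨p + 1, (map_dualEdge_symm_faceBoundary p).symm⟩)
  simpa [Finset.map_map] using h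

/-! ### Commuting projections -/

section Projections

variable {ι A : Type*}

theorem mul_mul_eq_zero_of_semiconjBy [Ring A] {p q u : A} (hqp : q * p = p) (hpq : p * q = p)
    (hu : SemiconjBy u q (1 - q)) : p * u * p = 0 :=
  calc p * u * p = p * (u * q) * p := by rw [mul_assoc, mul_assoc, mul_assoc, hqp]
    _ = (p - p * q) * u * p := by rw [hu.eq, ← mul_assoc, mul_sub, mul_one]
    _ = 0 := by rw [hpq, sub_self, zero_mul, zero_mul]

/-- If `q * p = 0`, then conjugating by `u` gives `(1 - q) * p = 0` as well, hence `p = 0`. -/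
theorem mul_ne_zero_of_semiconjBy [Ring A] {p q u : A} (hu : IsUnit u)
    (huq : SemiconjBy u q (1 - q)) (hup : Commute u p) (hp : p ≠ 0) : q * p ≠ 0 := fun h => by
  have h' : p * u = 0 :=
    calc p * u = (1 - q) * u * p + q * p * u := by rw [mul_assoc _ u, hup.eq]; noncomm_ring
      _ = 0 := by rw [← huq.eq, mul_assoc, h, mul_zero, zero_mul, zero_add]
  exact hp ((hu.mul_left_eq_zero).1 h')

theorem mul_noncommProd_of_mem [Monoid A] {s : Finset ι} {q : ι → A} (comm) {i : ι} (hi : i ∈ s)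
    (hq : IsIdempotentElem (q i)) : q i * s.noncommProd q comm = s.noncommProd q comm := by
  classical
  rw [← Finset.mul_noncommProd_erase s hi q comm, ← mul_assoc, hq.eq]

theorem noncommProd_mul_of_forall [Monoid A] {s : Finset ι} {q : ι → A} (comm) {p : A}
    (h : ∀ i ∈ s, q i * p = p) : s.noncommProd q comm * p = p :=
  s.noncommProd_induction q comm (fun a => a * p = p)
    (fun a b ha hb => by rw [mul_assoc, hb, ha]) (one_mul p) h

theorem isStarProjection_noncommProd [Semiring A] [StarRing A] {s : Finset ι} {q : ι → A} (comm)
    (hq : ∀ i ∈ s, IsStarProjection (q i)) : IsStarProjection (s.noncommProd q comm) := by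
  classical
  induction s using Finset.induction_on with
  | empty => exact .one A
  | insert i s hi ih =>
    rw [Finset.noncommProd_insert_of_notMem s i q comm hi]
    refine (hq i (Finset.mem_insert_self i s)).mul
      (ih _ fun j hj => hq j (Finset.mem_insert_of_mem hj)) ?_
    refine Finset.noncommProd_commute _ _ _ _ fun j hj => ?_
    exact comm (Finset.mem_insert_self i s) (Finset.mem_insert_of_mem hj) (by grind)

theorem noncommProd_ne_zero_of_exists_semiconjBy [Ring A] [Nontrivial A] {s : Finset ι} {q : ι → A}
    (comm) (h : ∀ t ⊆ s, t.Nonempty → ∃ i ∈ t, ∃ u, IsUnit u ∧ SemiconjBy u (q i) (1 - q i) ∧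
      ∀ j ∈ t, j ≠ i → Commute u (q j)) : s.noncommProd q comm ≠ 0 := by
  classical
  induction s using Finset.strongInduction with
  | H s ih =>
    rcases s.eq_empty_or_nonempty with rfl | hs
    · exact one_ne_zero
    obtain ⟨i, hi, u, hu, hui, hus⟩ := h s subset_rfl hs
    rw [← Finset.mul_noncommProd_erase s hi q comm]
    refine mul_ne_zero_of_semiconjBy hu hui ?_ (ih _ (Finset.erase_ssubset hi) _ ?_)
    · refine Finset.noncommProd_commute _ _ _ _ fun j hj => ?_
      exact hus j (Finset.mem_of_mem_erase hj) (Finset.ne_of_mem_erase hj)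
    · exact fun t ht => h t (ht.trans (Finset.erase_subset i s))

section Involution

variable {𝕜 : Type*} [Field 𝕜] [Ring A] [Algebra 𝕜 A] {s u : A}

theorem mul_half_smul_one_add (hs : s * s = 1) :
    s * ((1 / 2 : 𝕜) • (1 + s)) = (1 / 2 : 𝕜) • (1 + s) := by
  rw [mul_smul_comm, mul_add, hs, mul_one, add_comm]

theorem commute_half_smul_one_add (h : Commute u s) : Commute u ((1 / 2 : 𝕜) • (1 + s)) :=
  ((Commute.one_right u).add_right h).smul_right _

variable [NeZero (2 : 𝕜)]

theorem isStarProjection_half_smul_one_add [StarRing 𝕜] [StarRing A] [StarModule 𝕜 A]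
    (hs : s * s = 1) (hs' : IsSelfAdjoint s) : IsStarProjection ((1 / 2 : 𝕜) • (1 + s)) where
  isIdempotentElem := by
    rw [IsIdempotentElem, smul_mul_assoc, add_mul, one_mul, mul_half_smul_one_add hs, ← two_smul 𝕜,
      smul_smul, one_div_mul_cancel two_ne_zero, one_smul]
  isSelfAdjoint := by
    rw [IsSelfAdjoint, star_smul, star_add, star_one, hs'.star_eq]
    simp

theorem semiconjBy_half_smul_one_add (h : SemiconjBy u s (-s)) :
    SemiconjBy u ((1 / 2 : 𝕜) • (1 + s)) (1 - (1 / 2 : 𝕜) • (1 + s)) := by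
  have add_eq_two : 1 + -s + (1 + s) = (2 : 𝕜) • 1 := by
    rw [two_smul]
    abel
  have h_neg : (1 / 2 : 𝕜) • (1 + -s) = 1 - (1 / 2 : 𝕜) • (1 + s) := by
    rw [eq_sub_iff_add_eq, ← smul_add, add_eq_two, smul_smul, one_div_mul_cancel two_ne_zero,
      one_smul]
  rw [← h_neg]
  exact ((SemiconjBy.one_right u).add_right h).smul_right _

end Involution

end Projections

/-! ### Pauli strings -/

/-- The product of the Pauli matrices `σ^x_e`, `e ∈ a`. -/
noncomputable def xString (a : Finset Edge) : Op :=
  a.noncommProd sigmaX fun _ _ _ _ _ => sigmaX_comm _ _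

/-- The product of the Pauli matrices `σ^z_e`, `e ∈ b`. -/
noncomputable def zString (b : Finset Edge) : Op :=
  b.noncommProd sigmaZ fun _ _ _ _ _ => sigmaZ_comm _ _

theorem xString_apply (a : Finset Edge) (ψ : Hilb) (c : Finset Edge) : xString a ψ c = ψ (c ∆ a) :=
  prod_sigmaX_apply a ψ c

theorem zString_apply (b : Finset Edge) (ψ : Hilb) (c : Finset Edge) :
    zString b ψ c = overlapSign b c * ψ c := by
  rw [overlapSign_eq_prod]
  exact prod_sigmaZ_apply b ψ c

theorem op_mul_apply (S T : Op) (ψ : Hilb) (c : Finset Edge) : (S * T) ψ c = S (T ψ) c := rfl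

theorem op_smul_apply (z : ℂ) (T : Op) (ψ : Hilb) (c : Finset Edge) : (z • T) ψ c = z * T ψ c := rfl

theorem op_sum_apply {ι : Type*} (s : Finset ι) (T : ι → Op) (ψ : Hilb) (c : Finset Edge) :
    (∑ i ∈ s, T i) ψ c = ∑ i ∈ s, T i ψ c := by
  rw [sum_apply, lp.coeFn_sum, Finset.sum_apply]

theorem xString_empty : xString ∅ = 1 := Finset.noncommProd_empty _ _

theorem zString_empty : zString ∅ = 1 := Finset.noncommProd_empty _ _

theorem xString_symmDiff (a b : Finset Edge) : xString (a ∆ b) = xString a * xString b :=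
  op_ext fun ψ c => by simp only [op_mul_apply, xString_apply, symmDiff_assoc]

theorem zString_symmDiff (a b : Finset Edge) : zString (a ∆ b) = zString a * zString b :=
  op_ext fun ψ c => by
    simp only [op_mul_apply, zString_apply, overlapSign_comm _ c, overlapSign_symmDiff_right,
      mul_assoc]

theorem xString_mul_self (a : Finset Edge) : xString a * xString a = 1 := by
  rw [← xString_symmDiff, symmDiff_self]
  exact xString_empty

theorem zString_mul_self (b : Finset Edge) : zString b * zString b = 1 := by
  rw [← zString_symmDiff, symmDiff_self]
  exact zString_empty

theorem isUnit_xString (a : Finset Edge) : IsUnit (xString a) :=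
  ⟨⟨_, _, xString_mul_self a, xString_mul_self a⟩, rfl⟩

theorem isUnit_zString (b : Finset Edge) : IsUnit (zString b) :=
  ⟨⟨_, _, zString_mul_self b, zString_mul_self b⟩, rfl⟩

theorem commute_xString (a b : Finset Edge) : Commute (xString a) (xString b) := by
  rw [commute_iff_eq, ← xString_symmDiff, symmDiff_comm, xString_symmDiff]

theorem commute_zString (a b : Finset Edge) : Commute (zString a) (zString b) := by
  rw [commute_iff_eq, ← zString_symmDiff, symmDiff_comm, zString_symmDiff]

theorem semiconjBy_xString_zString (a b : Finset Edge) :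
    SemiconjBy (xString a) (zString b) (overlapSign a b • zString b) :=
  op_ext fun ψ c => by
    simp only [op_mul_apply, op_smul_apply, xString_apply, zString_apply, overlapSign_comm a b,
      overlapSign_symmDiff_right]
    ring

theorem semiconjBy_zString_xString (a b : Finset Edge) :
    SemiconjBy (zString b) (xString a) (overlapSign a b • xString a) := by
  rw [SemiconjBy, smul_mul_assoc, (semiconjBy_xString_zString a b).eq, smul_mul_assoc, smul_smul,
    overlapSign_mul_self, one_smul]

theorem coe_inside_symmDiff {Λ a : Finset Edge} (ha : a ⊆ Λ) (c : Finset Edge) :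
    (inside Λ (c ∆ a) : Finset Edge) = (inside Λ c : Finset Edge) ∆ a :=
  (inf_symmDiff_distrib_right c a Λ).trans (congrArg _ (inf_of_le_left ha))

theorem glue_symmDiff {Λ a : Finset Edge} (ha : a ⊆ Λ) (c : Finset Edge) (s : Λ.powerset) :
    glue Λ (c ∆ a) s = glue Λ c s := by
  ext e
  have := @ha e
  simp only [glue, Finset.mem_symmDiff, Finset.mem_union, Finset.mem_sdiff]
  tauto

theorem xString_eq_amplify {a Λ : Finset Edge} (ha : a ⊆ Λ) :
    xString a =
      amplify Λ
        (Matrix.of fun s t => if (t : Finset Edge) = (s : Finset Edge) ∆ a then 1 else 0) := by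
  refine op_ext fun ψ c => ?_
  have nonzero_iff (t : Λ.powerset) :
      (t : Finset Edge) = (inside Λ c : Finset Edge) ∆ a ↔ t = inside Λ (c ∆ a) := by
    rw [← coe_inside_symmDiff ha, Subtype.ext_iff]
  simp only [xString_apply, amplify_apply, Matrix.of_apply, nonzero_iff]
  rw [Finset.sum_eq_single_of_mem (inside Λ (c ∆ a)) (Finset.mem_univ _)
    fun t _ ht => by rw [if_neg ht, zero_mul], if_pos rfl, one_mul, ← glue_symmDiff ha, glue_inside]

theorem zString_eq_amplify {b Λ : Finset Edge} (hb : b ⊆ Λ) :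
    zString b = amplify Λ (Matrix.diagonal fun s => overlapSign b s) := by
  refine op_ext fun ψ c => ?_
  have sign_inside : overlapSign b (inside Λ c) = overlapSign b c := by
    rw [overlapSign, inside, Finset.inter_left_comm, Finset.inter_eq_left.2 hb, overlapSign_comm,
      overlapSign]
  simp [zString_apply, amplify_apply, Matrix.diagonal_apply, sign_inside, glue_inside]

theorem xString_mem_localAlg {a Λ : Finset Edge} (ha : a ⊆ Λ) : xString a ∈ localAlg Λ :=
  ⟨_, (xString_eq_amplify ha).symm⟩

theorem zString_mem_localAlg {b Λ : Finset Edge} (hb : b ⊆ Λ) : zString b ∈ localAlg Λ :=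
  ⟨_, (zString_eq_amplify hb).symm⟩

theorem isSelfAdjoint_xString (a : Finset Edge) : IsSelfAdjoint (xString a) := by
  rw [xString_eq_amplify subset_rfl]
  refine IsSelfAdjoint.map (Matrix.ext fun s t => ?_) (amplify a)
  have entry_comm : (s : Finset Edge) = (t : Finset Edge) ∆ a ↔
      (t : Finset Edge) = (s : Finset Edge) ∆ a := by
    rw [← symmDiff_left_inj (b := a), symmDiff_symmDiff_cancel_right, eq_comm]
  simp [Matrix.star_apply, entry_comm, apply_ite]

theorem isSelfAdjoint_zString (b : Finset Edge) : IsSelfAdjoint (zString b) := by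
  rw [zString_eq_amplify subset_rfl]
  refine IsSelfAdjoint.map ?_ (amplify b)
  rw [IsSelfAdjoint, Matrix.star_eq_conjTranspose, Matrix.diagonal_conjTranspose]
  congr 1
  funext s
  rcases overlapSign_eq_one_or b s with h | h <;> simp [h]

theorem amplify_single_apply (Λ : Finset Edge) (s t : Λ.powerset) (ψ : Hilb) (c : Finset Edge) :
    amplify Λ (Matrix.single s t 1) ψ c = if s = inside Λ c then ψ (glue Λ c t) else 0 := by
  simp [amplify_apply, Matrix.single_apply, ite_and]

theorem amplify_single_self (Λ : Finset Edge) (t : Λ.powerset) :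
    amplify Λ (Matrix.single t t 1) =
      ((2 : ℂ) ^ #Λ)⁻¹ • ∑ b ∈ Λ.powerset, overlapSign b t • zString b := by
  refine op_ext fun ψ c => ?_
  have disjoint_iff : Disjoint Λ ((t : Finset Edge) ∆ c) ↔ t = inside Λ c := by
    rw [Finset.disjoint_iff_inter_eq_empty, ← Finset.inf_eq_inter,
      inf_symmDiff_distrib_left, Finset.inf_eq_inter, Finset.inf_eq_inter,
      Finset.inter_eq_right.2 (Finset.mem_powerset.1 t.2), Finset.inter_comm Λ c, Subtype.ext_iff]
    exact symmDiff_eq_bot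
  simp only [op_smul_apply, op_sum_apply, zString_apply, ← mul_assoc, ← Finset.sum_mul,
    ← overlapSign_symmDiff_right, sum_powerset_overlapSign, disjoint_iff, amplify_single_apply]
  split_ifs with h
  · rw [h, glue_inside, inv_mul_cancel₀ (pow_ne_zero _ two_ne_zero), one_mul]
  · rw [mul_zero, zero_mul]

theorem symmDiff_subset_of_powerset {Λ : Finset Edge} (s t : Λ.powerset) :
    (s ∆ t : Finset Edge) ⊆ Λ :=
  Finset.symmDiff_subset_union.trans
    (Finset.union_subset (Finset.mem_powerset.1 s.2) (Finset.mem_powerset.1 t.2))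

theorem amplify_single (Λ : Finset Edge) (s t : Λ.powerset) :
    amplify Λ (Matrix.single s t 1) = xString (s ∆ t) * amplify Λ (Matrix.single t t 1) := by
  refine op_ext fun ψ c => ?_
  have inside_eq_iff : t = inside Λ (c ∆ (s ∆ t)) ↔ s = inside Λ c := by
    rw [Subtype.ext_iff, Subtype.ext_iff, coe_inside_symmDiff (symmDiff_subset_of_powerset s t)]
    rw [eq_comm, ← symmDiff_assoc, symmDiff_eq_right, symmDiff_eq_bot, eq_comm]
  rw [op_mul_apply, xString_apply, amplify_single_apply, amplify_single_apply,
    glue_symmDiff (symmDiff_subset_of_powerset s t)]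
  simp only [inside_eq_iff]

theorem localAlg_subset_span_pauli (Λ : Finset Edge) :
    (localAlg Λ : Set Op) ⊆ Submodule.span ℂ
      {T : Op | ∃ a ∈ Λ.powerset, ∃ b ∈ Λ.powerset, xString a * zString b = T} := by
  rintro _ ⟨M, rfl⟩
  change amplify Λ M ∈ Submodule.span ℂ _
  have single_mem (s t : Λ.powerset) : amplify Λ (Matrix.single s t 1) ∈ Submodule.span ℂ
      {T : Op | ∃ a ∈ Λ.powerset, ∃ b ∈ Λ.powerset, xString a * zString b = T} := by
    rw [amplify_single, amplify_single_self, mul_smul_comm, Finset.mul_sum]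
    refine Submodule.smul_mem _ _ (Submodule.sum_mem _ fun b hb => ?_)
    rw [mul_smul_comm]
    exact Submodule.smul_mem _ _ (Submodule.subset_span
      ⟨_, Finset.mem_powerset.2 (symmDiff_subset_of_powerset s t), b, hb, rfl⟩)
  rw [Matrix.matrix_eq_sum_single M, map_sum]
  refine Submodule.sum_mem _ fun s _ => ?_
  rw [map_sum]
  refine Submodule.sum_mem _ fun t _ => ?_
  rw [← mul_one (M s t), ← smul_eq_mul, ← Matrix.smul_single, map_smul]
  exact Submodule.smul_mem _ _ (single_mem s t)

/-! ### The net of ground state projections -/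

theorem stabilizer_mem_localAlg_iff {Λ : Finset Edge} {w : Site} :
    stabilizer w ∈ localAlg Λ ↔ support w ⊆ Λ := by
  refine ⟨support_subset_of_mem Λ w, fun h => ?_⟩
  cases w with
  | inl v => exact xString_mem_localAlg h
  | inr p => exact zString_mem_localAlg h

theorem stabilizer_mul_self (w : Site) : stabilizer w * stabilizer w = 1 := by
  cases w with
  | inl v => exact xString_mul_self (vertexStar v)
  | inr p => exact zString_mul_self (faceBoundary p)

theorem isSelfAdjoint_stabilizer (w : Site) : IsSelfAdjoint (stabilizer w) := by
  cases w with
  | inl v => exact isSelfAdjoint_xString (vertexStar v)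
  | inr p => exact isSelfAdjoint_zString (faceBoundary p)

theorem sign_mul_self (f : SignConfig) (w : Site) : ((f w : ℤ) : ℂ) * ((f w : ℤ) : ℂ) = 1 := by
  rcases Int.units_eq_one_or (f w) with h | h <;> simp [h]

theorem sign_smul_stabilizer_mul_self (f : SignConfig) (w : Site) :
    ((f w : ℤ) : ℂ) • stabilizer w * ((f w : ℤ) : ℂ) • stabilizer w = 1 := by
  rw [smul_mul_smul_comm, sign_mul_self, stabilizer_mul_self, one_smul]

theorem isStarProjection_siteProj (f : SignConfig) (w : Site) : IsStarProjection (siteProj f w) :=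
  isStarProjection_half_smul_one_add (sign_smul_stabilizer_mul_self f w)
    (IsSelfAdjoint.smul (by simp [IsSelfAdjoint]) (isSelfAdjoint_stabilizer w))

theorem stabilizer_mul_siteProj (f : SignConfig) (w : Site) :
    stabilizer w * siteProj f w = ((f w : ℤ) : ℂ) • siteProj f w := by
  have h : ((f w : ℤ) : ℂ) • stabilizer w * siteProj f w = siteProj f w :=
    mul_half_smul_one_add (sign_smul_stabilizer_mul_self f w)
  rw [← h, smul_mul_assoc, smul_smul, sign_mul_self, one_smul, ← smul_mul_assoc, h]

theorem semiconjBy_siteProj (f : SignConfig) {w : Site} {U : Op}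
    (h : SemiconjBy U (stabilizer w) (-stabilizer w)) :
    SemiconjBy U (siteProj f w) (1 - siteProj f w) :=
  semiconjBy_half_smul_one_add (by simpa only [smul_neg] using h.smul_right ((f w : ℤ) : ℂ))

theorem commute_siteProj (f : SignConfig) {w : Site} {U : Op} (h : Commute U (stabilizer w)) :
    Commute U (siteProj f w) :=
  commute_half_smul_one_add (h.smul_right _)

theorem mem_sites_iff (f : SignConfig) {Λ : Finset Edge} {w : Site} :
    w ∈ (finite_siteProj_mem f Λ).toFinset ↔ support w ⊆ Λ := by
  rw [Set.Finite.mem_toFinset, Set.mem_ofPred_eq, siteProj_mem_iff, stabilizer_mem_localAlg_iff]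

theorem groundProj_mem_localAlg (f : SignConfig) (Λ : Finset Edge) : groundProj f Λ ∈ localAlg Λ :=
  Finset.noncommProd_induction _ (siteProj f) _ (· ∈ localAlg Λ) (fun _ _ => mul_mem) (one_mem _)
    fun _ hw => (finite_siteProj_mem f Λ).mem_toFinset.1 hw

theorem isStarProjection_groundProj (f : SignConfig) (Λ : Finset Edge) :
    IsStarProjection (groundProj f Λ) :=
  isStarProjection_noncommProd _ fun w _ => isStarProjection_siteProj f w

/-- An edge of the support of a site that lies as far to the right as possible. -/
def rightEdge : Site → Edge
  | Sum.inl (x, y) => (x, y, false)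
  | Sum.inr (x, y) => (x + 1, y, true)

/-- The first coordinate of a site. -/
def abscissa : Site → ℤ := Sum.elim Prod.fst Prod.fst

/-- The single-edge Pauli matrix that flips the sign of the stabilizer of a site `w` and preserves
those of the sites to its left. -/
noncomputable def flip (w : Site) : Op :=
  match w with
  | Sum.inl _ => zString {rightEdge w}
  | Sum.inr _ => xString {rightEdge w}

theorem isUnit_flip (w : Site) : IsUnit (flip w) := by
  cases w with
  | inl v => exact isUnit_zString _
  | inr p => exact isUnit_xString _

theorem semiconjBy_flip_stabilizer (w : Site) :
    SemiconjBy (flip w) (stabilizer w) (-stabilizer w) := by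
  rcases w with ⟨x, y⟩ | ⟨x, y⟩
  · have h := semiconjBy_zString_xString (vertexStar (x, y)) {(x, y, false)}
    rwa [overlapSign_singleton_right, if_pos (by simp [vertexStar]), neg_one_smul] at h
  · have h := semiconjBy_xString_zString {(x + 1, y, true)} (faceBoundary (x, y))
    rwa [overlapSign_comm, overlapSign_singleton_right, if_pos (by simp [faceBoundary]),
      neg_one_smul] at h

theorem commute_flip_stabilizer {w w' : Site} (hne : w' ≠ w) (hle : abscissa w' ≤ abscissa w) :
    Commute (flip w) (stabilizer w') := by
  rcases w with ⟨x, y⟩ | ⟨x, y⟩ <;> rcases w' with ⟨x', y'⟩ | ⟨x', y'⟩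
  · have h := semiconjBy_zString_xString (vertexStar (x', y')) {(x, y, false)}
    have notMem : (x, y, false) ∉ vertexStar (x', y') := by
      simp [vertexStar, abscissa] at hne hle ⊢
      omega
    rwa [overlapSign_singleton_right, if_neg notMem, one_smul] at h
  · exact commute_zString _ _
  · exact commute_xString _ _
  · have h := semiconjBy_xString_zString {(x + 1, y, true)} (faceBoundary (x', y'))
    have notMem : (x + 1, y, true) ∉ faceBoundary (x', y') := by
      simp [faceBoundary, abscissa] at hne hle ⊢
      omega
    rwa [overlapSign_comm, overlapSign_singleton_right, if_neg notMem, one_smul] at h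

instance : Nontrivial Hilb :=
  nontrivial_of_ne (basisVec ∅) 0 fun h => by
    simpa [basisVec_apply] using congrArg (fun ψ : Hilb => ψ ∅) h

theorem groundProj_ne_zero (f : SignConfig) (Λ : Finset Edge) : groundProj f Λ ≠ 0 := by
  refine noncommProd_ne_zero_of_exists_semiconjBy _ fun F _ hF => ?_
  obtain ⟨w, hw, hmax⟩ := F.exists_max_image abscissa hF
  exact ⟨w, hw, flip w, isUnit_flip w, semiconjBy_siteProj f (semiconjBy_flip_stabilizer w),
    fun w' hw' hne => commute_siteProj f (commute_flip_stabilizer hne (hmax w' hw'))⟩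

theorem siteProj_mul_groundProj (f : SignConfig) {Λ : Finset Edge} {w : Site} (h : support w ⊆ Λ) :
    siteProj f w * groundProj f Λ = groundProj f Λ :=
  mul_noncommProd_of_mem _ ((mem_sites_iff f).2 h) (isStarProjection_siteProj f w).isIdempotentElem

theorem groundProj_mul_siteProj (f : SignConfig) {Λ : Finset Edge} {w : Site} (h : support w ⊆ Λ) :
    groundProj f Λ * siteProj f w = groundProj f Λ := by
  have comm : Commute (siteProj f w) (groundProj f Λ) :=
    Finset.noncommProd_commute _ _ _ _ fun w' _ => siteProj_comm f w w'
  rw [← comm.eq, siteProj_mul_groundProj f h]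

theorem groundProj_mul_groundProj (f : SignConfig) {Λ' Λ : Finset Edge} (h : Λ' ⊆ Λ) :
    groundProj f Λ' * groundProj f Λ = groundProj f Λ :=
  noncommProd_mul_of_forall _ fun _ hw =>
    siteProj_mul_groundProj f (((mem_sites_iff f).1 hw).trans h)

theorem isFrustrationFreeNet_groundProj (f : SignConfig) : IsFrustrationFreeNet (groundProj f) where
  mem_localAlg := groundProj_mem_localAlg f
  isStarProjection := isStarProjection_groundProj f
  ne_zero := groundProj_ne_zero f
  le_of_subset Λ' Λ h := (isStarProjection_groundProj f Λ).le_of_mul_eq_right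
    (isStarProjection_groundProj f Λ') (groundProj_mul_groundProj f h)

/-! ### Local topological quantum order -/

theorem localTrace_smul (Λ : Finset Edge) (z : ℂ) (T : Op) :
    localTrace Λ (z • T) = z * localTrace Λ T := by
  simp only [localTrace, inner_basisVec, op_smul_apply, Finset.mul_sum]

theorem localTrace_ne_zero {Λ : Finset Edge} {P : Op} (hmem : P ∈ localAlg Λ)
    (hP : IsStarProjection P) (hne : P ≠ 0) : localTrace Λ P ≠ 0 := by
  obtain ⟨M, rfl⟩ := hmem
  change IsStarProjection (amplify Λ M) at hP
  have gram : amplify Λ M = amplify Λ (M.conjTranspose * M) := by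
    rw [map_mul, ← Matrix.star_eq_conjTranspose, map_star, hP.isSelfAdjoint.star_eq,
      hP.isIdempotentElem.eq]
  intro h
  change localTrace Λ (amplify Λ M) = 0 at h
  open ComplexOrder in
  rw [gram, localTrace_amplify, Matrix.trace_conjTranspose_mul_self_eq_zero_iff] at h
  exact hne (by rw [h]; exact map_zero (amplify Λ))

theorem IsFrustrationFreeNet.compression_eq_localState_smul {Q : Finset Edge → Op}
    (hQ : IsFrustrationFreeNet Q) {Λ : Finset Edge} {X : Op} (h : Q Λ * X * Q Λ ∈ ℂ ∙ Q Λ) :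
    Q Λ * X * Q Λ = localState Q Λ X • Q Λ := by
  obtain ⟨z, hz⟩ := Submodule.mem_span_singleton.1 h
  rw [localState, ← hz, localTrace_smul, mul_div_cancel_right₀ _
    (localTrace_ne_zero (hQ.mem_localAlg Λ) (hQ.isStarProjection Λ) (hQ.ne_zero Λ))]

section Eigenvalue

variable {α ι 𝕜 A : Type*} [DecidableEq α] [CommSemiring 𝕜] [Semiring A] [Algebra 𝕜 A]

theorem mul_mul_mem_span_singleton {a b p : A} (ha : a * p ∈ 𝕜 ∙ p) (hb : b * p ∈ 𝕜 ∙ p) :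
    a * b * p ∈ 𝕜 ∙ p := by
  obtain ⟨z, hz⟩ := Submodule.mem_span_singleton.1 hb
  rw [mul_assoc, ← hz, mul_smul_comm]
  exact Submodule.smul_mem _ _ ha

theorem eventually_mul_mem_span_of_symmDiffClosure {M : Finset α → A} (h_empty : M ∅ = 1)
    (h_symmDiff : ∀ a b, M (a ∆ b) = M a * M b) {l : Filter ι} {P : ι → A} {𝒢 : Set (Finset α)}
    (h𝒢 : ∀ a ∈ 𝒢, ∀ᶠ i in l, M a * P i ∈ 𝕜 ∙ P i) {a : Finset α} (ha : SymmDiffClosure 𝒢 a) :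
    ∀ᶠ i in l, M a * P i ∈ 𝕜 ∙ P i := by
  induction ha with
  | empty =>
    refine .of_forall fun i => ?_
    rw [h_empty, one_mul]
    exact Submodule.mem_span_singleton_self _
  | basic ha => exact h𝒢 _ ha
  | symmDiff _ _ iha ihb =>
    filter_upwards [iha, ihb] with i ha hb
    rw [h_symmDiff]
    exact mul_mul_mem_span_singleton ha hb

end Eigenvalue

theorem eventually_stabilizer_mul_groundProj (f : SignConfig) (w : Site) :
    ∀ᶠ Δ in atTop, stabilizer w * groundProj f Δ ∈ ℂ ∙ groundProj f Δ := by
  filter_upwards [eventually_ge_atTop (support w)] with Δ hΔ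
  rw [← siteProj_mul_groundProj f hΔ, ← mul_assoc, stabilizer_mul_siteProj, smul_mul_assoc]
  exact Submodule.smul_mem _ _ (Submodule.mem_span_singleton_self _)

theorem eventually_compression_eq_zero (f : SignConfig) {w : Site} {T : Op}
    (hT : SemiconjBy T (stabilizer w) (-stabilizer w)) :
    ∀ᶠ Δ in atTop, groundProj f Δ * T * groundProj f Δ = 0 := by
  filter_upwards [eventually_ge_atTop (support w)] with Δ hΔ
  exact mul_mul_eq_zero_of_semiconjBy (siteProj_mul_groundProj f hΔ) (groundProj_mul_siteProj f hΔ)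
    (semiconjBy_siteProj f hT)

theorem IsCocycle.eventually_xString_mul_groundProj {a : Finset Edge} (ha : IsCocycle a)
    (f : SignConfig) : ∀ᶠ Δ in atTop, xString a * groundProj f Δ ∈ ℂ ∙ groundProj f Δ := by
  refine eventually_mul_mem_span_of_symmDiffClosure xString_empty xString_symmDiff ?_
    ha.symmDiffClosure
  rintro _ ⟨v, rfl⟩
  exact eventually_stabilizer_mul_groundProj f (.inl v)

theorem IsCycle.eventually_zString_mul_groundProj {b : Finset Edge} (hb : IsCycle b)
    (f : SignConfig) : ∀ᶠ Δ in atTop, zString b * groundProj f Δ ∈ ℂ ∙ groundProj f Δ := by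
  refine eventually_mul_mem_span_of_symmDiffClosure zString_empty zString_symmDiff ?_
    hb.symmDiffClosure
  rintro _ ⟨p, rfl⟩
  exact eventually_stabilizer_mul_groundProj f (.inr p)

theorem exists_semiconjBy_neg_of_not_isCycle {b : Finset Edge} (hb : ¬IsCycle b)
    (a : Finset Edge) :
    ∃ w, SemiconjBy (xString a * zString b) (stabilizer w) (-stabilizer w) := by
  obtain ⟨v, hv⟩ := not_forall.1 hb
  have h := semiconjBy_zString_xString (vertexStar v) b
  rw [(overlapSign_eq_one_or _ _).resolve_left hv, neg_one_smul] at h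
  exact ⟨.inl v, SemiconjBy.mul_left (commute_xString a (vertexStar v)).neg_right h⟩

theorem exists_semiconjBy_neg_of_not_isCocycle {a : Finset Edge} (ha : ¬IsCocycle a)
    (b : Finset Edge) :
    ∃ w, SemiconjBy (xString a * zString b) (stabilizer w) (-stabilizer w) := by
  obtain ⟨p, hp⟩ := not_forall.1 ha
  have h := semiconjBy_xString_zString a (faceBoundary p)
  rw [overlapSign_comm, (overlapSign_eq_one_or _ _).resolve_left hp, neg_one_smul] at h
  exact ⟨.inr p, SemiconjBy.mul_left h (commute_zString b (faceBoundary p))⟩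

theorem eventually_compression_pauli_mem_span (f : SignConfig) (a b : Finset Edge) :
    ∀ᶠ Δ in atTop,
      groundProj f Δ * (xString a * zString b) * groundProj f Δ ∈ ℂ ∙ groundProj f Δ := by
  by_cases h : IsCocycle a ∧ IsCycle b
  · filter_upwards [h.1.eventually_xString_mul_groundProj f,
      h.2.eventually_zString_mul_groundProj f] with Δ ha hb
    refine mul_mul_mem_span_singleton ?_ (mul_mul_mem_span_singleton ha hb)
    rw [(isStarProjection_groundProj f Δ).isIdempotentElem.eq]
    exact Submodule.mem_span_singleton_self _
  · obtain ⟨w, hw⟩ : ∃ w, SemiconjBy (xString a * zString b) (stabilizer w) (-stabilizer w) := by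
      rcases not_and_or.1 h with ha | hb
      · exact exists_semiconjBy_neg_of_not_isCocycle ha b
      · exact exists_semiconjBy_neg_of_not_isCycle hb a
    filter_upwards [eventually_compression_eq_zero f hw] with Δ hΔ
    exact hΔ ▸ Submodule.zero_mem _

theorem eventually_compression_mem_span (f : SignConfig) (Λ : Finset Edge) :
    ∀ᶠ Δ in atTop, ∀ X ∈ localAlg Λ,
      groundProj f Δ * X * groundProj f Δ ∈ ℂ ∙ groundProj f Δ := by
  have pauli : ∀ᶠ Δ in atTop, ∀ a ∈ Λ.powerset, ∀ b ∈ Λ.powerset,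
      groundProj f Δ * (xString a * zString b) * groundProj f Δ ∈ ℂ ∙ groundProj f Δ := by
    simp only [eventually_all_finset]
    exact fun a _ b _ => eventually_compression_pauli_mem_span f a b
  filter_upwards [pauli] with Δ hΔ X hX
  have span_le : Submodule.span ℂ
        {T : Op | ∃ a ∈ Λ.powerset, ∃ b ∈ Λ.powerset, xString a * zString b = T} ≤
      (ℂ ∙ groundProj f Δ).comap (LinearMap.mulLeftRight ℂ (groundProj f Δ, groundProj f Δ)) := by
    rw [Submodule.span_le]
    rintro _ ⟨a, ha, b, hb, rfl⟩
    exact hΔ a ha b hb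
  exact span_le (localAlg_subset_span_pauli Λ hX)

theorem eventually_compression_eq_localState_smul (f : SignConfig) (Λ : Finset Edge) :
    ∀ᶠ Δ in atTop, ∀ X ∈ localAlg Λ, groundProj f Δ * X * groundProj f Δ =
      localState (groundProj f) Δ X • groundProj f Δ := by
  filter_upwards [eventually_compression_mem_span f Λ] with Δ hΔ X hX
  exact (isFrustrationFreeNet_groundProj f).compression_eq_localState_smul (hΔ X hX)

theorem isLTQO_of_eventually_eq {Q : Finset Edge → Op}
    (h : ∀ Λ, ∀ᶠ Δ in atTop, ∀ X ∈ localAlg Λ, Q Δ * X * Q Δ = localState Q Δ X • Q Δ) :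
    IsLTQO Q := fun X hX => by
  obtain ⟨Λ, hΛ⟩ := Set.mem_iUnion.1 hX
  refine tendsto_const_nhds.congr' ?_
  filter_upwards [h Λ] with Δ hΔ
  rw [hΔ X hΛ, sub_self, norm_zero]

end ToricCode

theorem theorem3p6 (f : ToricCode.SignConfig) :
    ToricCode.IsFrustrationFreeNet (ToricCode.groundProj f) ∧
    ToricCode.IsLTQO (ToricCode.groundProj f) ∧
    ∀ Λ : Finset ToricCode.Edge, ∃ Δ : Finset ToricCode.Edge, Λ ⊆ Δ ∧
      ∀ X ∈ ToricCode.localAlg Λ,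
        ToricCode.groundProj f Δ * X * ToricCode.groundProj f Δ =
          ToricCode.localState (ToricCode.groundProj f) Δ X • ToricCode.groundProj f Δ := by
  have exact_compression := ToricCode.eventually_compression_eq_localState_smul f
  refine ⟨ToricCode.isFrustrationFreeNet_groundProj f,
    ToricCode.isLTQO_of_eventually_eq exact_compression, fun Λ => ?_⟩
  obtain ⟨Δ, hΔ, hΛΔ⟩ := ((exact_compression Λ).and (eventually_ge_atTop Λ)).exists
  exact ⟨Δ, hΛΔ, hΔ⟩
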